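/- **Setting.** Let $0\le\rho_0<\rho_1<1$, $R_s\ge 0$, and let $\delta_{sp},\delta_s,\delta_p,\upsilon_s,\upsilon_p,\upsilon_{sp},\upsilon_\emptyset\ge 0$ sum to $1$ (probabilities of the seven decoding outcomes $1,\dots,7$ at the secondary receiver). Put $D_s=\delta_s+\delta_{sp}+\upsilon_s+\upsilon_{sp}$ and $D_p=\delta_p+\delta_{sp}+\upsilon_p+\upsilon_{sp}$. Consider the Markov decision process with states $\mathcal S=\{b: b=0,1,2,\dots\}\cup\{\overset{\leftrightarrow}{K},\overset{\rightarrow}{K}\}$, initial state $0$, actions $a\in\{0,1\}$ ($a=1$: the secondary user (SU) transmits), and the following transition probabilities $P(\cdot\mid s,a)$. * From $b\ge0$: to $b+1$ with probability $\rho_1a\upsilon_s$, to $\overset{\leftrightarrow}{K}$ with probability $\rho_1a\upsilon_{sp}$, to $\overset{\rightarrow}{K}$ with probability $\rho_a(D_p-a\upsilon_{sp})$; if $b>0$, it stays in $b$ with probability $\rho_a(1-D_p-a\upsilon_s)$ and moves to $0$ with probability $1-\rho_a$; if $b=0$, it stays in $0$ with probability $1-\rho_a(D_p+a\upsilon_s)$.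 * From $\overset{\leftrightarrow}{K}$: to $0$ with probability $1-\rho_a$, to $\overset{\leftrightarrow}{K}$ with probability $\rho_a(1-D_p+a\upsilon_{sp})$, to $\overset{\rightarrow}{K}$ with probability $\rho_a(D_p-a\upsilon_{sp})$. * From $\overset{\rightarrow}{K}$: to $0$ with probability $1-\rho_a$, to $\overset{\rightarrow}{K}$ with probability $\rho_a$. In each slot the feedback consists of the decoding outcome in $\{1,\dots,7\}$, which has the above law, and an ACK, which is independent of it given $a$ and has probability $1-\rho_a$. An ACK leads to state $0$. Without an ACK (NACK), $\overset{\rightarrow}{K}$ is kept, and from any other state the outcomes $1$ ($\delta_{sp}$), $3$ ($\delta_p$), $5$ ($\upsilon_p$) lead to $\overset{\rightarrow}{K}$, outcome $6$ ($\upsilon_{sp}$) leads to $\overset{\leftrightarrow}{K}$ if $a=1$ and to $\overset{\rightarrow}{K}$ if $a=0$, outcome $4$ ($\upsilon_s$) leads from $b$ to $b+1$ if $a=1$, and in all other cases the state does not change. The SU reward is $v_S(a,b)=R_s[a(\delta_{sp}+\delta_s)+D_pb]$, $v_S(a,\overset{\leftrightarrow}{K})=R_s[a(D_s-\upsilon_{sp})+D_p]$,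 $v_S(a,\overset{\rightarrow}{K})=aR_sD_s$. A policy $\mu$ chooses, in each slot, the probability of $a_t=1$ as a function of the past actions and feedbacks. Put $$\nabla_{\max}=\frac{\rho_1-\rho_0}{1-\rho_0},\qquad \nabla(\mu)=\nabla_{\max}\limsup_{D\to\infty}\mathbb E\Big[\frac1D\sum_{t<D}a_t\Big],\qquad \bar T_S(\mu)=\liminf_{D\to\infty}\mathbb E\Big[\frac1D\sum_{t<D}v_S(a_t,s_t)\Big].$$ A policy is optimal for $\nabla_{th}\in(0,1)$ if it maximizes $\bar T_S(\mu)$ over all policies with $\nabla(\mu)\le\nabla_{th}$, and is itself one of them. Let $T_{GA}(\epsilon)=\epsilon R_sD_s$, $$\nabla_{GA}=\frac{\rho_0D_p}{1-\rho_1+\rho_0D_p}\nabla_{\max},\qquad \zeta=\frac{\upsilon_{sp}}{1-\rho_1(1-D_p+\upsilon_{sp})}+\frac{\upsilon_s}{1-\rho_1(1-D_p)}.$$ **Theorem.** (i) If $\nabla_{GA}<\nabla_{th}<\nabla_{\max}$, then the stationary policy $\mu^*$ with $$\mu^*(0)=\frac{\nabla_{th}-\nabla_{GA}}{\nabla_{\max}-\nabla_{GA}+(\nabla_{\max}-\nabla_{th})\frac{(\rho_1-\rho_0)D_p+\rho_1\upsilon_s}{1-\rho_1+\rho_0D_p}}\in(0,1),\qquad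 \mu^*(s)=1\ \text{ for all } s\ne0,$$ is optimal. For it $\nabla(\mu^*)=\nabla_{th}$ and $$\bar T_S(\mu^*)=T_{GA}\Big(\frac{\nabla_{th}}{\nabla_{\max}}\Big)-\frac{(1-\rho_1)(1-\rho_1+\rho_0D_p)\zeta R_s}{1-\rho_1(1-D_p)}\cdot\frac{\nabla_{th}-\nabla_{GA}}{\nabla_{\max}};$$ if $\rho_0D_p>0$, the subtracted term equals $\frac{\rho_0D_p(1-\rho_1)\zeta R_s}{1-\rho_1(1-D_p)}\cdot\frac{\nabla_{th}-\nabla_{GA}}{\nabla_{GA}}$. (ii) If $\nabla_{th}\ge\nabla_{\max}$, the policy $\mu^*(s)=1$ for all $s\in\mathcal S$ (Always-TX) is optimal, $\nabla(\mu^*)=\nabla_{\max}$ and $$\bar T_S(\mu^*)=T_{GA}(1)-\frac{(1-\rho_1)^2}{1-\rho_1(1-D_p)}\zeta R_s.$$ In both cases the limits defining $\nabla(\mu^*)$ and $\bar T_S(\mu^*)$ exist. -/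

import Mathlib

open Filter Topology

namespace ChainDecoding

/-- The seven decoding outcomes at the secondary receiver (SUrx) when both packets are on the air:
`1` both `l_P` and `l_S` decoded, `2` only `l_S`, `3` only `l_P`, `4` `l_P → l_S`, `5` `l_S → l_P`,
`6` `l_S ↔ l_P`, `7` failure. An arrow `X → Y` means that `Y` becomes decodable once `X` is removed,
but not vice versa. -/
inductive Region
  | both | onlyS | onlyP | PtoS | StoP | mutual | fail
  deriving DecidableEq

instance : Fintype Region where
  elems := {.both, .onlyS, .onlyP, .PtoS, .StoP, .mutual, .fail}
  complete := by intro y; cases y <;> decide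

/-- The parameters of the model: the failure probabilities `ρ₀ < ρ₁` of the PU when the SU is idle,
respectively transmits, the SU rate `R_s`, and the probabilities of the seven decoding outcomes. -/
structure Model where
  ρ₀ : ℝ
  ρ₁ : ℝ
  Rs : ℝ
  prob : Region → ℝ
  ρ₀_nonneg : 0 ≤ ρ₀
  ρ₀_lt_ρ₁ : ρ₀ < ρ₁
  ρ₁_lt_one : ρ₁ < 1
  Rs_nonneg : 0 ≤ Rs
  prob_nonneg : ∀ y, 0 ≤ prob y
  prob_sum : ∑ y, prob y = 1

/-- States of the chain decoding protocol: `U b` (the current PU packet is virtually undecodable and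
`b` SU packets wait for it), `Kboth` (PU packet virtually decodable, mutually connected to the CD
root), `Kright` (PU packet known, or decodable from the CD root but not vice versa). -/
inductive CDState
  | U (b : ℕ) | Kboth | Kright
  deriving DecidableEq

/-- What happens in one slot: access decision (`tx = true` iff the SU transmits), decoding
feedback `y_S` and ARQ feedback `y_P` (`ack = true` iff the PU packet is received). -/
structure Slot where
  tx : Bool
  yS : Region
  ack : Bool
  deriving DecidableEq, Fintype

/-- The history of the past slots, most recent slot first. -/
abbrev History := List Slot

/-- A (randomized, history dependent) access policy: the probability of transmitting in the current
slot, given the history. -/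
abbrev Policy := History → unitInterval

/-- Update of the state when the PU fails, so that its packet is going to be retransmitted: outcomes
`1, 3, 5` (and `6` if the SU is idle) make `l_P` known, or decodable from the CD root but not vice
versa; if the SU transmits, `6` connects `l_P` and the CD root mutually, and `4` makes one more SU
packet wait for `l_P`. -/
def CDState.nack (s : CDState) (tx : Bool) (y : Region) : CDState :=
  match s, y with
  | .Kright, _ => .Kright
  | _, .both => .Kright
  | _, .onlyP => .Kright
  | _, .StoP => .Kright
  | _, .mutual => if tx then .Kboth else .Kright
  | .U b, .PtoS => if tx then .U (b + 1) else .U b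
  | s, _ => s

/-- State update: a new ARQ window (state `U 0`) starts after an ACK. -/
def CDState.next (s : CDState) (o : Slot) : CDState :=
  if o.ack then .U 0 else s.nack o.tx o.yS

/-- The state at the beginning of the current slot; initially a new ARQ window starts. -/
def stateOf : History → CDState
  | [] => .U 0
  | o :: h => (stateOf h).next o

/-- The stationary state-dependent policy with access probabilities `m`. -/
def stationary (m : CDState → unitInterval) : Policy := fun h => m (stateOf h)

namespace Model

variable (M : Model)

/-- `ρ_a`. -/
def rho (a : Bool) : ℝ := if a then M.ρ₁ else M.ρ₀

/-- `D_s`: interference-free decoding probability of the SU packet. -/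
def Ds : ℝ := M.prob .onlyS + M.prob .both + M.prob .PtoS + M.prob .mutual

/-- `D_p`: interference-free decoding probability of the PU packet. -/
def Dp : ℝ := M.prob .onlyP + M.prob .both + M.prob .StoP + M.prob .mutual

/-- `υ_s`, the probability of `l_P → l_S`. -/
def υs : ℝ := M.prob .PtoS

/-- `υ_sp`, the probability of `l_S ↔ l_P`. -/
def υsp : ℝ := M.prob .mutual

/-- Probability of the slot outcome `o` when the SU transmits with probability `x`: given the access
decision, the feedbacks of the two receivers are independent. -/
noncomputable def slotProb (x : ℝ) (o : Slot) : ℝ :=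
  (if o.tx then x else 1 - x) * M.prob o.yS * (if o.ack then 1 - M.rho o.tx else M.rho o.tx)

/-- Expectation of a function of the history of the first `t` slots under a policy. -/
noncomputable def expect (μ : Policy) : ℕ → (History → ℝ) → ℝ
  | 0, f => f []
  | t + 1, f => expect μ t fun h => ∑ o : Slot, M.slotProb (μ h) o * f (o :: h)

/-- The transition probabilities `P(x | s, a)` of the protocol. -/
def trans (s : CDState) (a : Bool) (x : CDState) : ℝ :=
  let A : ℝ := if a then 1 else 0
  match s, x with
  | .U b, .U c =>
      (if c = 0 ∧ b = 0 then 1 - M.rho a * (M.Dp + A * M.υs) else 0)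
      + (if c = 0 ∧ 0 < b then 1 - M.rho a else 0)
      + (if c = b ∧ 0 < b then M.rho a * (1 - M.Dp - A * M.υs) else 0)
      + (if c = b + 1 then M.ρ₁ * A * M.υs else 0)
  | .U _, .Kboth => M.ρ₁ * A * M.υsp
  | .U _, .Kright => M.rho a * (M.Dp - A * M.υsp)
  | .Kboth, .U c => if c = 0 then 1 - M.rho a else 0
  | .Kboth, .Kboth => M.rho a * (1 - M.Dp + A * M.υsp)
  | .Kboth, .Kright => M.rho a * (M.Dp - A * M.υsp)
  | .Kright, .U c => if c = 0 then 1 - M.rho a else 0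
  | .Kright, .Kboth => 0
  | .Kright, .Kright => M.rho a

/-- The expected virtual instantaneous throughput `v_S(a, s)`. -/
def reward (a : Bool) : CDState → ℝ
  | .U b => M.Rs * ((if a then M.prob .both + M.prob .onlyS else 0) + M.Dp * b)
  | .Kboth => M.Rs * ((if a then M.Ds - M.υsp else 0) + M.Dp)
  | .Kright => if a then M.Rs * M.Ds else 0

/-- `∑ a_{S,t}` over the slots of a history. -/
def txCount : History → ℝ
  | [] => 0
  | o :: h => (if o.tx then 1 else 0) + txCount h

/-- `∑ v_S(a_{S,t}, s_t)` over the slots of a history. -/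
def totalReward : History → ℝ
  | [] => 0
  | o :: h => M.reward o.tx (stateOf h) + totalReward h

/-- `E[(1/D) ∑_{t<D} a_{S,t}]`. -/
noncomputable def avgTx (μ : Policy) (D : ℕ) : ℝ := M.expect μ D fun h => 1 / (D : ℝ) * txCount h

/-- `E[(1/D) ∑_{t<D} v_S(a_{S,t}, s_t)]`. -/
noncomputable def avgReward (μ : Policy) (D : ℕ) : ℝ :=
  M.expect μ D fun h => 1 / (D : ℝ) * M.totalReward h

/-- `∇_max`. -/
noncomputable def nablaMax : ℝ := (M.ρ₁ - M.ρ₀) / (1 - M.ρ₀)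

/-- The degradation `∇(μ)` of the PU throughput (the limit superior is the limit if this exists). -/
noncomputable def degradation (μ : Policy) : ℝ := M.nablaMax * limsup (M.avgTx μ) atTop

/-- The average long-term SU throughput. -/
noncomputable def throughput (μ : Policy) : ℝ := liminf (M.avgReward μ) atTop

/-- `μ` solves the problem: maximize the SU throughput over all policies, subject to a PU throughput
degradation of at most `θ`. -/
def IsOptimal (θ : ℝ) (μ : Policy) : Prop :=
  M.degradation μ ≤ θ ∧ ∀ ν : Policy, M.degradation ν ≤ θ → M.throughput ν ≤ M.throughput μ

/-- `∇_GA = π(K→) ∇_max`, with `π(K→) = ρ₀ D_p / (1 - ρ₁ + ρ₀ D_p)` the steady-state probability of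
`Kright` when the SU is idle in state `U 0` and transmits in state `Kright`. -/
noncomputable def nablaGA : ℝ := M.ρ₀ * M.Dp / (1 - M.ρ₁ + M.ρ₀ * M.Dp) * M.nablaMax

/-- The genie-aided SU throughput with transmission probability `ε`. -/
def genie (ε : ℝ) : ℝ := ε * M.Rs * M.Ds

/-- The constant `ζ`. -/
noncomputable def zeta : ℝ :=
  M.υsp / (1 - M.ρ₁ * (1 - M.Dp + M.υsp)) + M.υs / (1 - M.ρ₁ * (1 - M.Dp))

/-- The slot outcomes drive the state according to the transition probabilities `trans`. -/
theorem sum_next_eq_trans (s x : CDState) (a : Bool) :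
    ∑ y : Region, ∑ k : Bool,
      (if s.next ⟨a, y, k⟩ = x then M.prob y * (if k then 1 - M.rho a else M.rho a) else 0)
      = M.trans s a x := by
  have h1 := M.prob_sum
  have hR : (Finset.univ : Finset Region) =
      {.both, .onlyS, .onlyP, .PtoS, .StoP, .mutual, .fail} := rfl
  rw [hR] at h1
  simp at h1
  rw [hR]
  have h7 : M.prob .fail = 1 - (M.prob .both + M.prob .onlyS + M.prob .onlyP + M.prob .PtoS
    + M.prob .StoP + M.prob .mutual) := by linarith
  rcases s with b | _ | _ <;> rcases x with c | _ | _ <;> cases a <;>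
    simp [CDState.next, CDState.nack, trans, rho, Dp, υs, υsp, h7]
  all_goals first
    | (split_ifs <;> first | omega | ring1)
    | ring1

end Model

end ChainDecoding

namespace ChainDecoding

/-! The argument is Lagrangian duality with an explicit solution of the average-reward Bellman
equation. Charge `price` per transmission and write h for `relValue`. If the SU transmits with
probability x in state s, the mean of net reward plus h at the next state is h(s) + `gain` - (1 - x)
* `idleLoss` s (`slotMean_relValue`). Here `idleLoss` is nonnegative and vanishes in `U 0`:
transmitting is optimal everywhere, and in `U 0` idling is equally good.

Summing over slots and using h ≥ 0 gives average reward ≤ `gain` + `price` * average access for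
every policy (`avgReward_le`). As `price` ≥ 0, a bound ε on the access rate caps the throughput at
`gain` + `price` * ε (`throughput_le`). A stationary policy that is idle only in `U 0` loses
nothing, and the mean of h stays bounded although h is not, so it attains the cap at its own access
rate (`tendsto_avgReward`). That rate comes from a second Poisson equation (`tendsto_avgTx`); in
case (i) `m (U 0)` is tuned so that the constraint is tight.

The constants are forced. A waiting packet earns R_s D_p per slot until the states `U b` are left,
at rate `exitRate`, hence the slope of h in b. Idling in `U 0` gives `gain` = ρ₀ D_p h(`Kright`);
transmitting in `Kright` then gives `price`. -/

/-! ### One-slot means -/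

lemma sum_region (f : Region → ℝ) :
    ∑ y, f y = f .both + f .onlyS + f .onlyP + f .PtoS + f .StoP + f .mutual + f .fail := by
  have hR : (Finset.univ : Finset Region) =
      {.both, .onlyS, .onlyP, .PtoS, .StoP, .mutual, .fail} := rfl
  rw [hR]
  simp
  ring

/-- A slot is a triple of an access decision and the two feedbacks. -/
def slotEquiv : Bool × Region × Bool ≃ Slot where
  toFun p := ⟨p.1, p.2.1, p.2.2⟩
  invFun o := (o.tx, o.yS, o.ack)
  left_inv _ := rfl
  right_inv _ := rfl

lemma sum_slot (f : Slot → ℝ) :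
    ∑ o, f o = ∑ y, (f ⟨true, y, true⟩ + f ⟨true, y, false⟩ + f ⟨false, y, true⟩
      + f ⟨false, y, false⟩) := by
  rw [← slotEquiv.sum_comp, Fintype.sum_prod_type, Fintype.sum_bool, Fintype.sum_prod_type,
    Fintype.sum_prod_type, ← Finset.sum_add_distrib]
  refine Finset.sum_congr rfl fun y _ => ?_
  simp [slotEquiv]
  ring

namespace Model

variable (M : Model)

lemma prob_fail : M.prob .fail = 1 - (M.prob .both + M.prob .onlyS + M.prob .onlyP
    + M.prob .PtoS + M.prob .StoP + M.prob .mutual) := by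
  have h := M.prob_sum
  rw [sum_region] at h
  linarith

lemma slotProb_nonneg {x : ℝ} (h0 : 0 ≤ x) (h1 : x ≤ 1) (o : Slot) : 0 ≤ M.slotProb x o := by
  have hy := M.prob_nonneg o.yS
  have := M.ρ₀_nonneg
  have := M.ρ₀_lt_ρ₁
  have := M.ρ₁_lt_one
  unfold slotProb rho
  refine mul_nonneg (mul_nonneg ?_ hy) ?_ <;> split_ifs <;> linarith

/-- The mean over a slot of a quantity that depends on the access decision and the next state. -/
noncomputable def slotMean (x : ℝ) (r : Bool → ℝ) (f : CDState → ℝ) (s : CDState) : ℝ :=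
  ∑ o : Slot, M.slotProb x o * (r o.tx + f (s.next o))

variable {M}

/-- Normalizing `f` to vanish at `U 0` removes every ACK term, so only the NACK transitions remain
and `b = 0` needs no separate case. -/
lemma slotMean_U (x : ℝ) (r : Bool → ℝ) (f : CDState → ℝ) (hf : f (.U 0) = 0) (b : ℕ) :
    M.slotMean x r f (.U b) = x * r true + (1 - x) * r false
      + x * M.ρ₁ * ((M.Dp - M.υsp) * f .Kright + M.υsp * f .Kboth + M.υs * f (.U (b + 1))
        + (1 - M.Dp - M.υs) * f (.U b))
      + (1 - x) * M.ρ₀ * (M.Dp * f .Kright + (1 - M.Dp) * f (.U b)) := by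
  rw [slotMean, sum_slot, sum_region]
  simp only [slotProb, CDState.next, CDState.nack, rho, prob_fail, hf, Dp, υs, υsp, if_true,
    Bool.false_eq_true, if_false]
  ring

lemma slotMean_Kboth (x : ℝ) (r : Bool → ℝ) (f : CDState → ℝ) (hf : f (.U 0) = 0) :
    M.slotMean x r f .Kboth = x * r true + (1 - x) * r false
      + x * M.ρ₁ * ((M.Dp - M.υsp) * f .Kright + (1 - M.Dp + M.υsp) * f .Kboth)
      + (1 - x) * M.ρ₀ * (M.Dp * f .Kright + (1 - M.Dp) * f .Kboth) := by
  rw [slotMean, sum_slot, sum_region]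
  simp only [slotProb, CDState.next, CDState.nack, rho, prob_fail, hf, Dp, υsp, if_true,
    Bool.false_eq_true, if_false]
  ring

lemma slotMean_Kright (x : ℝ) (r : Bool → ℝ) (f : CDState → ℝ) (hf : f (.U 0) = 0) :
    M.slotMean x r f .Kright = x * r true + (1 - x) * r false
      + (x * M.ρ₁ + (1 - x) * M.ρ₀) * f .Kright := by
  rw [slotMean, sum_slot, sum_region]
  simp only [slotProb, CDState.next, CDState.nack, rho, prob_fail, hf, if_true,
    Bool.false_eq_true, if_false]
  ring

lemma sum_slotProb (x : ℝ) : ∑ o, M.slotProb x o = 1 := by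
  -- With `r = 1` and `f = 0` the slot mean is the total mass; the state is immaterial.
  have h := slotMean_Kright (M := M) x (fun _ => 1) (fun _ => 0) rfl
  simp only [slotMean, add_zero, mul_one] at h
  rw [h]
  ring

lemma sum_slotProb_add (x c : ℝ) (r : Bool → ℝ) (f : CDState → ℝ) (s : CDState) :
    ∑ o, M.slotProb x o * (c + (r o.tx + f (s.next o))) = c + M.slotMean x r f s := by
  simp only [mul_add, Finset.sum_add_distrib, ← Finset.sum_mul, sum_slotProb, slotMean,
    one_mul]

/-! ### Expectation along a policy and drift -/

lemma expect_mono (μ : Policy) (t : ℕ) {f g : History → ℝ} (h : ∀ l, f l ≤ g l) :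
    M.expect μ t f ≤ M.expect μ t g := by
  induction t generalizing f g with
  | zero => exact h _
  | succ t ih =>
    exact ih fun l => Finset.sum_le_sum fun o _ =>
      mul_le_mul_of_nonneg_left (h _) (M.slotProb_nonneg (μ l).2.1 (μ l).2.2 o)

lemma expect_add (μ : Policy) (t : ℕ) (f g : History → ℝ) :
    M.expect μ t (fun l => f l + g l) = M.expect μ t f + M.expect μ t g := by
  induction t generalizing f g with
  | zero => rfl
  | succ t ih => simp only [expect, mul_add, Finset.sum_add_distrib, ih]

lemma expect_const_mul (μ : Policy) (t : ℕ) (c : ℝ) (f : History → ℝ) :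
    M.expect μ t (fun l => c * f l) = c * M.expect μ t f := by
  induction t generalizing f with
  | zero => rfl
  | succ t ih => simp only [expect, mul_left_comm _ c, ← Finset.mul_sum, ih]

lemma expect_const (μ : Policy) (t : ℕ) (c : ℝ) : M.expect μ t (fun _ => c) = c := by
  induction t with
  | zero => rfl
  | succ t ih => simp only [expect, ← Finset.sum_mul, sum_slotProb, one_mul, ih]

/-- A supermartingale bound. Since `f` sees the whole history, it may contain accumulated rewards as
well as a function of the state. -/
lemma expect_le_of_drift (μ : Policy) (f : History → ℝ) (κ : ℝ)
    (h : ∀ l, ∑ o, M.slotProb (μ l) o * f (o :: l) ≤ f l + κ) (t : ℕ) :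
    M.expect μ t f ≤ f [] + κ * t := by
  induction t with
  | zero => simp [expect]
  | succ t ih =>
    have := expect_mono (M := M) μ t h
    rw [expect_add, expect_const] at this
    rw [expect]
    push_cast
    linarith

lemma expect_eq_of_drift (μ : Policy) (f : History → ℝ) (κ : ℝ)
    (h : ∀ l, ∑ o, M.slotProb (μ l) o * f (o :: l) = f l + κ) (t : ℕ) :
    M.expect μ t f = f [] + κ * t := by
  induction t with
  | zero => simp [expect]
  | succ t ih =>
    rw [expect, funext h, expect_add, expect_const, ih]
    push_cast
    ring

/-- A geometric drift towards zero keeps the expectation bounded. -/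
lemma expect_le_of_contraction (μ : Policy) (f : CDState → ℝ) {ρ K : ℝ} (hρ : 0 ≤ ρ)
    (h0 : f (.U 0) ≤ K) (h : ∀ (x : unitInterval) s, M.slotMean x (fun _ => 0) f s
      ≤ ρ * f s + (1 - ρ) * K) (t : ℕ) :
    M.expect μ t (fun l => f (stateOf l)) ≤ K := by
  induction t with
  | zero => exact h0
  | succ t ih =>
    have key : M.expect μ (t + 1) (fun l => f (stateOf l)) ≤
        M.expect μ t fun l => ρ * f (stateOf l) + (1 - ρ) * K := by
      refine expect_mono μ t fun l => ?_
      have := h (μ l) (stateOf l)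
      simpa only [slotMean, zero_add, stateOf] using this
    rw [expect_add, expect_const, expect_const_mul] at key
    nlinarith [mul_le_mul_of_nonneg_left ih hρ]

/-! ### A priori bounds on the averages -/

lemma avgTx_eq (μ : Policy) (D : ℕ) : M.avgTx μ D = 1 / (D : ℝ) * M.expect μ D txCount :=
  expect_const_mul _ _ _ _

lemma avgReward_eq (μ : Policy) (D : ℕ) :
    M.avgReward μ D = 1 / (D : ℝ) * M.expect μ D M.totalReward :=
  expect_const_mul _ _ _ _

lemma txCount_nonneg (l : History) : 0 ≤ txCount l := by
  induction l with
  | nil => exact le_rfl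
  | cons o l ih => rw [txCount]; split_ifs <;> linarith

lemma expect_nonneg (μ : Policy) (t : ℕ) {f : History → ℝ} (h : ∀ l, 0 ≤ f l) :
    0 ≤ M.expect μ t f := by
  simpa only [expect_const] using expect_mono (M := M) μ t h

lemma expect_txCount_le (μ : Policy) (t : ℕ) : M.expect μ t txCount ≤ t := by
  have h := expect_le_of_drift (M := M) μ txCount 1 (fun l => ?_) t
  · simpa [txCount] using h
  · have h2 := sum_slotProb_add (M := M) (μ l) (txCount l) (fun a => if a then 1 else 0)
      (fun _ => 0) .Kright
    rw [slotMean_Kright _ _ _ rfl] at h2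
    have := (μ l).2.2
    simp only [txCount, add_comm _ (txCount l)]
    simp only [add_zero] at h2
    rw [h2]
    simpa using this

lemma avgTx_nonneg (μ : Policy) (D : ℕ) : 0 ≤ M.avgTx μ D := by
  rw [avgTx_eq]
  exact mul_nonneg (by positivity) (expect_nonneg μ D txCount_nonneg)

lemma avgTx_le_one (μ : Policy) (D : ℕ) : M.avgTx μ D ≤ 1 := by
  rw [avgTx_eq, one_div, ← div_eq_inv_mul]
  exact div_le_one_of_le₀ (expect_txCount_le μ D) (Nat.cast_nonneg D)

/-! ### Inequalities between the parameters -/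

lemma υs_nonneg : 0 ≤ M.υs := M.prob_nonneg _

lemma υsp_nonneg : 0 ≤ M.υsp := M.prob_nonneg _

lemma υsp_le_Dp : M.υsp ≤ M.Dp := by
  have := M.prob_nonneg
  unfold υsp Dp
  linarith [this .onlyP, this .both, this .StoP]

lemma Dp_nonneg : 0 ≤ M.Dp := υsp_nonneg.trans υsp_le_Dp

lemma Dp_add_υs_le_one : M.Dp + M.υs ≤ 1 := by
  have h := M.prob_fail
  have := M.prob_nonneg
  unfold υs Dp
  linarith [this .fail, this .onlyS]

lemma υs_add_υsp_le_Ds : M.υs + M.υsp ≤ M.Ds := by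
  have := M.prob_nonneg
  unfold υs υsp Ds
  linarith [this .onlyS, this .both]

lemma ρ₁_pos : 0 < M.ρ₁ := M.ρ₀_nonneg.trans_lt M.ρ₀_lt_ρ₁

variable (M) in
/-- `1 - ρ₁ (1 - D_p)`. -/
def exitRate : ℝ := 1 - M.ρ₁ * (1 - M.Dp)

variable (M) in
/-- `1 - ρ₁ + ρ₀ D_p`. -/
def cycleRate : ℝ := 1 - M.ρ₁ + M.ρ₀ * M.Dp

lemma exitRate_pos : 0 < M.exitRate := by
  have := mul_nonneg M.ρ₁_pos.le M.Dp_nonneg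
  have := M.ρ₁_lt_one
  unfold exitRate
  linarith

lemma cycleRate_pos : 0 < M.cycleRate := by
  have := mul_nonneg M.ρ₀_nonneg M.Dp_nonneg
  have := M.ρ₁_lt_one
  unfold cycleRate
  linarith

lemma cycleRate_le_exitRate : M.cycleRate ≤ M.exitRate := by
  have := mul_le_mul_of_nonneg_right M.ρ₀_lt_ρ₁.le M.Dp_nonneg
  unfold exitRate cycleRate
  linarith

lemma one_sub_ρ₁_le_mutual : 1 - M.ρ₁ ≤ 1 - M.ρ₁ * (1 - M.Dp + M.υsp) := by
  have := mul_le_mul_of_nonneg_left M.υsp_le_Dp M.ρ₁_pos.le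
  linarith

lemma one_sub_ρ₁_le_exitRate : 1 - M.ρ₁ ≤ M.exitRate := by
  have := mul_nonneg M.ρ₁_pos.le M.Dp_nonneg
  unfold exitRate
  linarith

lemma zeta_nonneg : 0 ≤ M.zeta := by
  have h1 := M.one_sub_ρ₁_le_mutual
  have h2 := M.exitRate_pos
  have := M.ρ₁_lt_one
  unfold exitRate at h2
  exact add_nonneg (div_nonneg υsp_nonneg (by linarith)) (div_nonneg υs_nonneg h2.le)

/-- Both denominators in `zeta` are at least 1 - ρ₁, so the left side is at most υ_sp + υ_s. -/
lemma one_sub_ρ₁_mul_zeta_le : (1 - M.ρ₁) * M.zeta ≤ M.Ds := by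
  have h0 : 0 < 1 - M.ρ₁ := by linarith [M.ρ₁_lt_one]
  have h1 := M.one_sub_ρ₁_le_mutual
  have h2 := M.one_sub_ρ₁_le_exitRate
  unfold exitRate at h2
  have key : M.zeta ≤ M.υsp / (1 - M.ρ₁) + M.υs / (1 - M.ρ₁) :=
    add_le_add (div_le_div_of_nonneg_left υsp_nonneg h0 h1)
      (div_le_div_of_nonneg_left υs_nonneg h0 h2)
  have := mul_le_mul_of_nonneg_left key h0.le
  have e : (1 - M.ρ₁) * (M.υsp / (1 - M.ρ₁) + M.υs / (1 - M.ρ₁)) = M.υsp + M.υs := by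
    field_simp
  linarith [M.υs_add_υsp_le_Ds]

/-! ### Solution of the Bellman equation with priced transmissions -/

variable (M) in
/-- The relative value function of the unconstrained problem in which a transmission costs
`M.price`. -/
noncomputable def relValue : CDState → ℝ
  | .U b => M.Rs * (M.Dp / M.exitRate) * b
  | .Kboth => M.Rs * ((M.Dp + M.υs * (1 - M.ρ₁) / M.exitRate) / M.exitRate)
  | .Kright => M.Rs * ((1 - M.ρ₁) * M.zeta / M.exitRate)

variable (M) in
/-- The Lagrange multiplier: the cost of a transmission that makes both actions optimal in state
`U 0`. -/
noncomputable def price : ℝ := M.Rs * M.Ds - M.cycleRate * M.relValue .Kright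

variable (M) in
/-- The average gain of the problem in which a transmission costs `M.price`. -/
noncomputable def gain : ℝ := M.ρ₀ * M.Dp * M.relValue .Kright

variable (M) in
/-- The loss incurred by staying idle. -/
noncomputable def idleLoss : CDState → ℝ
  | .U b => M.Rs * (M.Dp / M.exitRate) * ((M.ρ₁ - M.ρ₀) * (1 - M.Dp)) * b
  | .Kboth => (1 - M.ρ₀ * (1 - M.Dp)) * M.relValue .Kboth - M.Rs * M.Dp
  | .Kright => (1 - M.ρ₀) * M.relValue .Kright + M.gain

lemma relValue_nonneg (s : CDState) : 0 ≤ M.relValue s := by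
  have := M.Rs_nonneg
  have := M.exitRate_pos
  have := M.Dp_nonneg
  have := M.υs_nonneg
  have := M.zeta_nonneg
  have : 0 ≤ 1 - M.ρ₁ := by linarith [M.ρ₁_lt_one]
  cases s <;> simp only [relValue] <;> positivity

lemma relValue_zero : M.relValue (.U 0) = 0 := by simp [relValue]

/-- The sign makes a bound on the access rate give a bound on the reward. It holds since `cycleRate`
≤ `exitRate` and (1 - ρ₁) ζ ≤ D_s. -/
lemma price_nonneg : 0 ≤ M.price := by
  have h1 : M.cycleRate / M.exitRate ≤ 1 := div_le_one_of_le₀ cycleRate_le_exitRate exitRate_pos.le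
  have h2 : 0 ≤ M.cycleRate / M.exitRate := div_nonneg cycleRate_pos.le exitRate_pos.le
  have h3 : 0 ≤ (1 - M.ρ₁) * M.zeta := mul_nonneg (by linarith [M.ρ₁_lt_one]) zeta_nonneg
  have h4 : M.cycleRate / M.exitRate * ((1 - M.ρ₁) * M.zeta) ≤ M.Ds :=
    (mul_le_of_le_one_left h3 h1).trans one_sub_ρ₁_mul_zeta_le
  have h5 : M.price = M.Rs * (M.Ds - M.cycleRate / M.exitRate * ((1 - M.ρ₁) * M.zeta)) := by
    simp only [price, relValue]
    ring
  rw [h5]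
  exact mul_nonneg M.Rs_nonneg (by linarith)

lemma gain_nonneg : 0 ≤ M.gain :=
  mul_nonneg (mul_nonneg M.ρ₀_nonneg Dp_nonneg) (relValue_nonneg _)

lemma idleLoss_nonneg (s : CDState) : 0 ≤ M.idleLoss s := by
  have hR := M.Rs_nonneg
  have hq := M.exitRate_pos
  have hD := M.Dp_nonneg
  have hυ := M.υs_nonneg
  have h1 : 0 ≤ 1 - M.ρ₁ := by linarith [M.ρ₁_lt_one]
  have h2 : 0 ≤ M.ρ₁ - M.ρ₀ := by linarith [M.ρ₀_lt_ρ₁]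
  have h3 : 0 ≤ 1 - M.Dp := by linarith [M.Dp_add_υs_le_one]
  rcases s with b | _ | _
  · simp only [idleLoss]
    positivity
  · have e : M.Rs * M.Dp ≤ M.exitRate * M.relValue .Kboth := by
      have : M.exitRate * M.relValue .Kboth
          = M.Rs * M.Dp + M.Rs * (M.υs * (1 - M.ρ₁) / M.exitRate) := by
        simp only [relValue]
        field_simp
      rw [this]
      have : 0 ≤ M.Rs * (M.υs * (1 - M.ρ₁) / M.exitRate) := by positivity
      linarith
    -- The coefficient 1 - ρ₀ (1 - D_p) in the loss exceeds `exitRate` by (ρ₁ - ρ₀)(1 - D_p).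
    have e2 := mul_nonneg (mul_nonneg h2 h3) (relValue_nonneg (M := M) .Kboth)
    simp only [idleLoss]
    unfold exitRate at e
    linarith
  · have := mul_nonneg (show 0 ≤ 1 - M.ρ₀ by linarith) (relValue_nonneg (M := M) .Kright)
    simp only [idleLoss]
    linarith [M.gain_nonneg]

lemma idleLoss_zero : M.idleLoss (.U 0) = 0 := by simp [idleLoss]

lemma exitRate_mul_relValue_U (b : ℕ) :
    M.exitRate * M.relValue (.U b) = M.Rs * M.Dp * b := by
  have := M.exitRate_pos
  simp only [relValue]
  field_simp

lemma exitRate_mul_relValue_Kboth :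
    (1 - M.ρ₁ * (1 - M.Dp)) * M.relValue .Kboth
      = M.Rs * (M.Dp + M.υs * ((1 - M.ρ₁) / M.exitRate)) := by
  have := M.exitRate_pos
  rw [← exitRate]
  simp only [relValue]
  field_simp

/-- The Bellman equations for transmission in `Kboth` and in every `U b` both reduce to this
identity, which clears the first denominator of `zeta`. -/
lemma mul_relValue_Kright :
    (1 - M.ρ₁ * (1 - M.Dp + M.υsp)) * M.relValue .Kright
      = M.Rs * M.υs * ((1 - M.ρ₁) / M.exitRate) + M.υsp * (M.Rs - M.ρ₁ * M.relValue .Kboth) := by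
  have hq := M.exitRate_pos.ne'
  have hm : 1 - M.ρ₁ * (1 - M.Dp + M.υsp) ≠ 0 :=
    ((sub_pos.2 M.ρ₁_lt_one).trans_le M.one_sub_ρ₁_le_mutual).ne'
  have hz : (1 - M.ρ₁ * (1 - M.Dp + M.υsp)) * M.zeta
      = M.υsp + (1 - M.ρ₁ * (1 - M.Dp + M.υsp)) * (M.υs / M.exitRate) := by
    rw [zeta, mul_add, mul_div_cancel₀ _ hm, exitRate]
  have hl : (1 - M.ρ₁ * (1 - M.Dp + M.υsp)) * M.relValue .Kright
      = M.Rs * (1 - M.ρ₁) / M.exitRate * ((1 - M.ρ₁ * (1 - M.Dp + M.υsp)) * M.zeta) := by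
    simp only [relValue]
    ring
  rw [hl, hz]
  simp only [relValue]
  have he : M.exitRate = 1 - M.ρ₁ * (1 - M.Dp) := rfl
  field_simp
  rw [he]
  ring

/-- The Bellman equation in state `Kboth`, for a transmitting SU. -/
lemma relValue_Kboth_eq :
    M.Rs * (M.Ds - M.υsp + M.Dp) - M.price
      + M.ρ₁ * ((M.Dp - M.υsp) * M.relValue .Kright + (1 - M.Dp + M.υsp) * M.relValue .Kboth)
      = M.relValue .Kboth + M.gain := by
  rw [price, gain, cycleRate]
  linear_combination M.mul_relValue_Kright - M.exitRate_mul_relValue_Kboth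

/-- The Bellman equation in state `U b`, for a transmitting SU. -/
lemma relValue_U_eq (b : ℕ) :
    M.Rs * (M.prob .both + M.prob .onlyS + M.Dp * b) - M.price
      + M.ρ₁ * ((M.Dp - M.υsp) * M.relValue .Kright + M.υsp * M.relValue .Kboth
        + M.υs * M.relValue (.U (b + 1)) + (1 - M.Dp - M.υs) * M.relValue (.U b))
      = M.relValue (.U b) + M.gain := by
  have h1 : M.relValue (.U (b + 1)) = M.relValue (.U b) + M.Rs * (M.Dp / M.exitRate) := by
    simp only [relValue]
    push_cast
    ring
  have h2 : M.ρ₁ * (M.Dp / M.exitRate) = 1 - (1 - M.ρ₁) / M.exitRate := by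
    have := M.exitRate_pos.ne'
    have he : M.exitRate = 1 - M.ρ₁ * (1 - M.Dp) := rfl
    field_simp
    rw [he]
    ring
  have h3 := M.exitRate_mul_relValue_U b
  have h4 : M.prob .both + M.prob .onlyS = M.Ds - M.υs - M.υsp := by
    rw [Ds, υs, υsp]
    ring
  rw [exitRate] at h3
  rw [h1, h4, price, gain, cycleRate]
  linear_combination M.mul_relValue_Kright - h3 + M.Rs * M.υs * h2

/-- The slot mean is affine in x: x = 1 is the Bellman equation for transmission, and the deficit at
x = 0 is `idleLoss`. -/
lemma slotMean_relValue (x : ℝ) (s : CDState) :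
    M.slotMean x (fun a => M.reward a s - M.price * (if a then 1 else 0)) M.relValue s
      = M.relValue s + M.gain - (1 - x) * M.idleLoss s := by
  rcases s with b | _ | _
  · rw [slotMean_U _ _ _ relValue_zero]
    have h := M.relValue_U_eq b
    have h2 := M.exitRate_mul_relValue_U b
    simp only [reward, idleLoss, gain, if_true, Bool.false_eq_true, if_false] at h ⊢
    have h3 : M.Rs * (M.Dp / M.exitRate) * ((M.ρ₁ - M.ρ₀) * (1 - M.Dp)) * b
      = (M.ρ₁ - M.ρ₀) * (1 - M.Dp) * M.relValue (.U b) := by simp only [relValue]; ring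
    rw [h3]
    unfold exitRate at h2
    linear_combination x * h + (1 - x) * (-h2)
  · rw [slotMean_Kboth _ _ _ relValue_zero]
    have h := M.relValue_Kboth_eq
    simp only [reward, idleLoss, gain, if_true, Bool.false_eq_true, if_false] at h ⊢
    linear_combination x * h
  · rw [slotMean_Kright _ _ _ relValue_zero]
    simp only [reward, idleLoss, gain, price, cycleRate, if_true, Bool.false_eq_true, if_false]
    ring

/-! ### The upper bound for arbitrary policies -/

variable (M) in
/-- The accumulated reward, net of the cost of transmissions, plus the value of the state. -/
noncomputable def netValue (l : History) : ℝ :=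
  M.totalReward l + -M.price * txCount l + M.relValue (stateOf l)

lemma sum_netValue (x : ℝ) (l : History) :
    ∑ o, M.slotProb x o * M.netValue (o :: l)
      = M.netValue l + M.gain - (1 - x) * M.idleLoss (stateOf l) := by
  have h := sum_slotProb_add (M := M) x (M.totalReward l + -M.price * txCount l)
    (fun a => M.reward a (stateOf l) - M.price * (if a then 1 else 0)) M.relValue (stateOf l)
  rw [slotMean_relValue] at h
  have e : ∀ o : Slot, M.netValue (o :: l) = M.totalReward l + -M.price * txCount l
      + (M.reward o.tx (stateOf l) - M.price * (if o.tx then 1 else 0)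
        + M.relValue ((stateOf l).next o)) := fun o => by
    simp only [netValue, totalReward, txCount, stateOf]
    ring
  simp only [e, h]
  rw [netValue]
  ring

lemma expect_netValue (μ : Policy) (t : ℕ) : M.expect μ t M.netValue
    = M.expect μ t M.totalReward - M.price * M.expect μ t txCount
      + M.expect μ t (fun l => M.relValue (stateOf l)) := by
  unfold netValue
  rw [expect_add, expect_add, expect_const_mul]
  ring

lemma netValue_nil : M.netValue [] = 0 := by
  simp [netValue, totalReward, txCount, stateOf, relValue_zero]

/-- `netValue` drifts by at most `gain` per slot, and its final term `relValue` is nonnegative and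
can be dropped. -/
lemma avgReward_le (μ : Policy) (D : ℕ) : M.avgReward μ D ≤ M.gain + M.price * M.avgTx μ D := by
  have h := expect_le_of_drift (M := M) μ M.netValue M.gain (fun l => by
    rw [sum_netValue]
    have := mul_nonneg (show 0 ≤ 1 - (μ l : ℝ) by linarith [(μ l).2.2])
      (idleLoss_nonneg (M := M) (stateOf l))
    linarith) D
  rw [expect_netValue, netValue_nil] at h
  have h2 := expect_nonneg (M := M) μ D fun l => relValue_nonneg (M := M) (stateOf l)
  rw [avgReward_eq, avgTx_eq]
  -- For `D = 0` both averages are 0, because `1 / 0 = 0`, and the claim is `gain` ≥ 0.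
  rcases D.eq_zero_or_pos with rfl | hD
  · simpa using M.gain_nonneg
  · have hD' : (0 : ℝ) < D := by exact_mod_cast hD
    rw [one_div, mul_left_comm, ← div_eq_inv_mul, ← div_eq_inv_mul, div_le_iff₀ hD', add_mul,
      div_mul_cancel₀ _ hD'.ne']
    linarith

lemma avgReward_nonneg (μ : Policy) (D : ℕ) : 0 ≤ M.avgReward μ D := by
  rw [avgReward_eq]
  refine mul_nonneg (by positivity) (expect_nonneg μ D fun l => ?_)
  have hp := M.prob_nonneg
  have hD := M.Dp_nonneg
  have h1 := M.υs_add_υsp_le_Ds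
  have h2 := M.υs_nonneg
  have h3 := M.υsp_nonneg
  induction l with
  | nil => exact le_rfl
  | cons o l ih =>
    refine add_nonneg ?_ ih
    rcases stateOf l with b | _ | _ <;> simp only [reward]
    · refine mul_nonneg M.Rs_nonneg (add_nonneg ?_ (by positivity))
      split_ifs
      · exact add_nonneg (hp _) (hp _)
      · exact le_rfl
    · refine mul_nonneg M.Rs_nonneg (add_nonneg ?_ hD)
      split_ifs <;> linarith
    · split_ifs
      · exact mul_nonneg M.Rs_nonneg (by linarith)
      · exact le_rfl

lemma throughput_le (ν : Policy) {ε : ℝ} (h : limsup (M.avgTx ν) atTop ≤ ε) :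
    M.throughput ν ≤ M.gain + M.price * ε := by
  have hb : IsBoundedUnder (· ≤ ·) atTop (M.avgTx ν) := isBoundedUnder_of ⟨1, avgTx_le_one ν⟩
  have hb' : IsBoundedUnder (· ≥ ·) atTop (M.avgReward ν) :=
    isBoundedUnder_of ⟨0, avgReward_nonneg ν⟩
  -- A limsup of at most ε only puts the averages eventually below ε + δ; δ tends to 0 afterwards.
  have key : ∀ δ > 0, M.throughput ν ≤ M.gain + M.price * (ε + δ) := fun δ hδ => by
    have ev : ∀ᶠ D in atTop, M.avgReward ν D ≤ M.gain + M.price * (ε + δ) :=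
      (eventually_lt_of_limsup_lt (lt_of_le_of_lt h (lt_add_of_pos_right ε hδ)) hb).mono
        fun D hD => (avgReward_le ν D).trans
          (by linarith [mul_le_mul_of_nonneg_left hD.le M.price_nonneg])
    exact liminf_le_of_frequently_le ev.frequently hb'
  have lim : Tendsto (fun δ : ℝ => M.gain + M.price * (ε + δ)) (𝓝[>] 0)
      (𝓝 (M.gain + M.price * (ε + 0))) :=
    (Continuous.tendsto (by fun_prop) 0).mono_left nhdsWithin_le_nhds
  rw [add_zero] at lim
  exact ge_of_tendsto lim (eventually_mem_nhdsWithin.mono fun δ hδ => key δ hδ)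

/-! ### Attainment by policies that are idle only in `U 0` -/

/-- The expected relative value stays bounded, because every slot is an ACK with probability at
least `1 - ρ₁`. -/
lemma exists_expect_relValue_le (μ : Policy) :
    ∃ K, ∀ t, M.expect μ t (fun l => M.relValue (stateOf l)) ≤ K := by
  have h1 : 0 < 1 - M.ρ₁ := sub_pos.2 M.ρ₁_lt_one
  have hρ := M.ρ₁_pos
  have hρ₀ := M.ρ₀_nonneg
  have hρ₁ := M.ρ₀_lt_ρ₁
  have hβ : 0 ≤ M.Rs * (M.Dp / M.exitRate) :=
    mul_nonneg M.Rs_nonneg (div_nonneg Dp_nonneg exitRate_pos.le)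
  have hB := M.relValue_nonneg .Kboth
  have hR := M.relValue_nonneg .Kright
  have hD := M.Dp_nonneg
  have hυ := M.υs_nonneg
  have hυ' := M.υsp_nonneg
  have hd : 0 ≤ M.Dp - M.υsp := sub_nonneg.2 M.υsp_le_Dp
  have hw : 0 ≤ 1 - M.Dp - M.υs := by linarith [M.Dp_add_υs_le_one]
  -- `C` bounds the increase of `relValue` over any NACK transition.
  set C := M.Rs * (M.Dp / M.exitRate) + M.relValue .Kboth + M.relValue .Kright with hC
  have mix : ∀ (x : unitInterval) (p q V : ℝ), p ≤ V → q ≤ V → 0 ≤ V →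
      x * M.ρ₁ * p + (1 - x) * M.ρ₀ * q ≤ M.ρ₁ * V := fun x p q V hp hq hV => by
    have e1 := mul_le_mul_of_nonneg_left hp (mul_nonneg x.2.1 hρ.le)
    have e2 := mul_le_mul_of_nonneg_left hq (mul_nonneg (sub_nonneg.2 x.2.2) hρ₀)
    have e3 := mul_nonneg (mul_nonneg (sub_nonneg.2 x.2.2) (sub_nonneg.2 hρ₁.le)) hV
    linarith
  -- The fixed point of v ↦ ρ₁ (v + C): a NACK has probability at most ρ₁, and an ACK resets the
  -- value to 0.
  refine ⟨M.ρ₁ * C / (1 - M.ρ₁), expect_le_of_contraction μ M.relValue hρ.le ?_ fun x s => ?_⟩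
  · rw [relValue_zero]
    positivity
  · rw [mul_div_cancel₀ _ h1.ne', ← mul_add]
    have hs := M.relValue_nonneg s
    rcases s with b | _ | _
    · rw [slotMean_U _ _ _ relValue_zero]
      have hb : M.relValue (.U (b + 1)) = M.relValue (.U b) + M.Rs * (M.Dp / M.exitRate) := by
        simp only [relValue]
        push_cast
        ring
      have e := mix x ((M.Dp - M.υsp) * M.relValue .Kright + M.υsp * M.relValue .Kboth
        + M.υs * M.relValue (.U (b + 1)) + (1 - M.Dp - M.υs) * M.relValue (.U b))
        (M.Dp * M.relValue .Kright + (1 - M.Dp) * M.relValue (.U b)) (M.relValue (.U b) + C)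
        ?_ ?_ (by positivity)
      · linarith
      · have a1 := mul_le_mul_of_nonneg_left (show M.relValue .Kright ≤ M.relValue (.U b) + C by
          linarith) hd
        have a2 := mul_le_mul_of_nonneg_left (show M.relValue .Kboth ≤ M.relValue (.U b) + C by
          linarith) hυ'
        have a3 := mul_le_mul_of_nonneg_left (show M.relValue (.U (b + 1))
          ≤ M.relValue (.U b) + C by linarith) hυ
        have a4 := mul_le_mul_of_nonneg_left (show M.relValue (.U b) ≤ M.relValue (.U b) + C by
          linarith) hw
        linarith
      · have a1 := mul_le_mul_of_nonneg_left (show M.relValue .Kright ≤ M.relValue (.U b) + C by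
          linarith) hD
        have a2 := mul_le_mul_of_nonneg_left (show M.relValue (.U b) ≤ M.relValue (.U b) + C by
          linarith) (show 0 ≤ 1 - M.Dp by linarith)
        linarith
    · rw [slotMean_Kboth _ _ _ relValue_zero]
      have e := mix x ((M.Dp - M.υsp) * M.relValue .Kright
        + (1 - M.Dp + M.υsp) * M.relValue .Kboth)
        (M.Dp * M.relValue .Kright + (1 - M.Dp) * M.relValue .Kboth) (M.relValue .Kboth + C)
        ?_ ?_ (by positivity)
      · linarith
      · have a1 := mul_le_mul_of_nonneg_left (show M.relValue .Kright ≤ M.relValue .Kboth + C by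
          linarith) hd
        have a2 := mul_le_mul_of_nonneg_left (show M.relValue .Kboth ≤ M.relValue .Kboth + C by
          linarith) (show 0 ≤ 1 - M.Dp + M.υsp by linarith)
        linarith
      · have a1 := mul_le_mul_of_nonneg_left (show M.relValue .Kright ≤ M.relValue .Kboth + C by
          linarith) hD
        have a2 := mul_le_mul_of_nonneg_left (show M.relValue .Kboth ≤ M.relValue .Kboth + C by
          linarith) (show 0 ≤ 1 - M.Dp by linarith)
        linarith
    · rw [slotMean_Kright _ _ _ relValue_zero]
      have e := mix x (M.relValue .Kright) (M.relValue .Kright) (M.relValue .Kright + C)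
        (by linarith) (by linarith) (by positivity)
      linarith

lemma tendsto_avg_of_bounded {u : ℕ → ℝ} {K : ℝ} (h : ∀ t, |u t| ≤ K) :
    Tendsto (fun D : ℕ => 1 / (D : ℝ) * u D) atTop (𝓝 0) := by
  refine squeeze_zero_norm (a := fun D : ℕ => 1 / (D : ℝ) * K) (fun D => ?_) ?_
  · rw [norm_mul, Real.norm_eq_abs, Real.norm_eq_abs, abs_of_nonneg (by positivity)]
    exact mul_le_mul_of_nonneg_left (h D) (by positivity)
  · simpa using tendsto_one_div_atTop_nhds_zero_nat.mul_const K

/-- The loss term vanishes in every state: `idleLoss` is 0 in `U 0`, and 1 - x is 0 elsewhere. So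
the drift of `netValue` is exactly `gain`, and the bounded mean of `relValue` disappears after
division by `D`. -/
lemma tendsto_avgReward {m : CDState → unitInterval} (hm : ∀ s, s ≠ .U 0 → m s = 1) {ε : ℝ}
    (h : Tendsto (M.avgTx (stationary m)) atTop (𝓝 ε)) :
    Tendsto (M.avgReward (stationary m)) atTop (𝓝 (M.gain + M.price * ε)) := by
  obtain ⟨K, hK⟩ := exists_expect_relValue_le (M := M) (stationary m)
  have hlim := tendsto_avg_of_bounded (K := K) (fun t => by
    rw [abs_of_nonneg (expect_nonneg (M := M) (stationary m) t fun l => relValue_nonneg _)]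
    exact hK t)
  have e := (((h.const_mul M.price).const_add M.gain).sub hlim)
  rw [sub_zero] at e
  refine e.congr' ((eventually_gt_atTop 0).mono fun D hD => ?_)
  have hD' : (D : ℝ) ≠ 0 := by exact_mod_cast hD.ne'
  have hd := expect_eq_of_drift (M := M) (stationary m) M.netValue M.gain (fun l => by
    rw [sum_netValue]
    by_cases hs : stateOf l = .U 0
    · rw [hs, idleLoss_zero]
      ring
    · simp [stationary, hm _ hs]) D
  rw [expect_netValue, netValue_nil] at hd
  rw [avgReward_eq, avgTx_eq]
  field_simp
  linarith

/-- The access rate of the policy that transmits with probability `m (U 0)` in state `U 0`, and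
always in the other states. -/
lemma tendsto_avgTx {m : CDState → unitInterval} (hm : ∀ s, s ≠ .U 0 → m s = 1) {ε : ℝ}
    (h : (1 - M.ρ₁) * ((m (.U 0) : ℝ) - ε) + (1 - ε) * (M.ρ₀ * M.Dp
      + m (.U 0) * ((M.ρ₁ - M.ρ₀) * M.Dp + M.ρ₁ * M.υs)) = 0) :
    Tendsto (M.avgTx (stationary m)) atTop (𝓝 ε) := by
  have h1 : 1 - M.ρ₁ ≠ 0 := (sub_pos.2 M.ρ₁_lt_one).ne'
  -- Solves 1 + ρ₁ k = k + ε, the Poisson equation outside `U 0`. The hypothesis `h` is the equation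
  -- in `U 0`, multiplied by 1 - ρ₁.
  set k := (1 - ε) / (1 - M.ρ₁) with hk
  have hk1 : (1 - M.ρ₁) * k = 1 - ε := mul_div_cancel₀ _ h1
  have hk2 : (m (.U 0) : ℝ) - ε
      + k * (M.ρ₀ * M.Dp + m (.U 0) * ((M.ρ₁ - M.ρ₀) * M.Dp + M.ρ₁ * M.υs)) = 0 := by
    refine (mul_eq_zero_iff_left h1).1 ?_
    linear_combination h + (M.ρ₀ * M.Dp
      + m (.U 0) * ((M.ρ₁ - M.ρ₀) * M.Dp + M.ρ₁ * M.υs)) * hk1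
  -- One value suffices outside `U 0`: there the SU always transmits, and each state returns to `U
  -- 0` exactly on an ACK, with probability 1 - ρ₁.
  let f : CDState → ℝ := fun s => if s = .U 0 then 0 else k
  have hf0 : f (.U 0) = 0 := if_pos rfl
  have hf : ∀ s, s ≠ .U 0 → f s = k := fun s hs => if_neg hs
  have step : ∀ s, M.slotMean (m s) (fun a => if a then 1 else 0) f s = f s + ε := fun s => by
    by_cases hs : s = .U 0
    · rw [hs, slotMean_U _ _ _ hf0, hf0, hf .Kright (by simp), hf .Kboth (by simp),
        hf (.U (0 + 1)) (by simp)]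
      simp only [if_true, Bool.false_eq_true, if_false]
      linear_combination hk2
    · rw [hm s hs, hf s hs]
      rcases s with b | _ | _
      · rw [slotMean_U _ _ _ hf0, hf .Kright (by simp), hf .Kboth (by simp),
          hf (.U (b + 1)) (by simp), hf _ hs]
        simp only [if_true, Bool.false_eq_true, if_false, Set.Icc.coe_one]
        linear_combination -hk1
      · rw [slotMean_Kboth _ _ _ hf0, hf .Kright (by simp), hf .Kboth (by simp)]
        simp only [if_true, Bool.false_eq_true, if_false, Set.Icc.coe_one]
        linear_combination -hk1
      · rw [slotMean_Kright _ _ _ hf0, hf .Kright (by simp)]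
        simp only [if_true, Bool.false_eq_true, if_false, Set.Icc.coe_one]
        linear_combination -hk1
  have hd := expect_eq_of_drift (M := M) (stationary m) (fun l => txCount l + f (stateOf l)) ε
    (fun l => by
      have e := sum_slotProb_add (M := M) (stationary m l) (txCount l)
        (fun a => if a then 1 else 0) f (stateOf l)
      rw [stationary, step] at e
      rw [stationary, add_assoc, ← e]
      refine Finset.sum_congr rfl fun o _ => ?_
      simp only [txCount, stateOf]
      ring)
  have hlim := tendsto_avg_of_bounded (u := fun t => M.expect (stationary m) t
    fun l => f (stateOf l)) (K := |k|) (fun t => by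
      have hb : ∀ s, -|k| ≤ f s ∧ f s ≤ |k| := fun s => by
        by_cases hs : s = .U 0
        · simp [hs, hf0]
        · rw [hf s hs]
          exact abs_le.1 le_rfl
      have u := expect_mono (M := M) (stationary m) t fun l => (hb (stateOf l)).2
      have v := expect_mono (M := M) (stationary m) t fun l => (hb (stateOf l)).1
      rw [expect_const] at u v
      exact abs_le.2 ⟨v, u⟩)
  have e := hlim.const_sub ε
  rw [sub_zero] at e
  refine e.congr' ((eventually_gt_atTop 0).mono fun D hD => ?_)
  have hD' : (D : ℝ) ≠ 0 := by exact_mod_cast hD.ne'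
  have hdD := hd D
  rw [expect_add] at hdD
  simp only [txCount, stateOf, hf0] at hdD
  rw [avgTx_eq]
  field_simp
  linarith

/-! ### Optimality and closed formulas -/

lemma isOptimal_of_tendsto {m : CDState → unitInterval} (hm : ∀ s, s ≠ .U 0 → m s = 1) {θ ε : ℝ}
    (h : Tendsto (M.avgTx (stationary m)) atTop (𝓝 ε)) (hθ : M.nablaMax * ε ≤ θ)
    (hε : ∀ ν, M.degradation ν ≤ θ → limsup (M.avgTx ν) atTop ≤ ε) :
    M.IsOptimal θ (stationary m) := by
  refine ⟨by rwa [degradation, h.limsup_eq], fun ν hν => ?_⟩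
  rw [throughput, throughput, (tendsto_avgReward hm h).liminf_eq]
  exact throughput_le ν (hε ν hν)

lemma nablaMax_pos : 0 < M.nablaMax :=
  div_pos (by linarith [M.ρ₀_lt_ρ₁]) (by linarith [M.ρ₀_lt_ρ₁, M.ρ₁_lt_one])

lemma degradation_le_iff {ν : Policy} {θ : ℝ} :
    M.degradation ν ≤ θ ↔ limsup (M.avgTx ν) atTop ≤ θ / M.nablaMax := by
  rw [degradation, le_div_iff₀' nablaMax_pos]

lemma limsup_avgTx_le_one (ν : Policy) : limsup (M.avgTx ν) atTop ≤ 1 :=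
  limsup_le_of_le (isCoboundedUnder_le_of_le atTop (avgTx_nonneg ν))
    (Eventually.of_forall (avgTx_le_one ν))

/-- The loss against the genie is `cycleRate` * h(`Kright`) times the excess of ε over ρ₀ D_p /
`cycleRate`, the access rate of the policy that is always idle in `U 0`. -/
lemma gain_add_price_mul (ε : ℝ) : M.gain + M.price * ε
    = M.genie ε - (1 - M.ρ₁) * M.cycleRate * M.zeta * M.Rs / M.exitRate *
      (ε - M.ρ₀ * M.Dp / M.cycleRate) := by
  have := M.cycleRate_pos.ne'
  simp only [gain, price, genie, relValue]
  field_simp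
  ring

/-- The probability of transmitting in state `U 0` that leads to the access rate `ε`. -/
lemma accessProb_mem {ε : ℝ} (h0 : M.ρ₀ * M.Dp / M.cycleRate < ε) (h1 : ε < 1) {x : ℝ}
    (hx : x = (ε - M.ρ₀ * M.Dp / M.cycleRate) / (1 - M.ρ₀ * M.Dp / M.cycleRate
      + (1 - ε) * (((M.ρ₁ - M.ρ₀) * M.Dp + M.ρ₁ * M.υs) / M.cycleRate))) :
    0 < x ∧ x < 1 ∧ (1 - M.ρ₁) * (x - ε) + (1 - ε) * (M.ρ₀ * M.Dp
      + x * ((M.ρ₁ - M.ρ₀) * M.Dp + M.ρ₁ * M.υs)) = 0 := by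
  have hc := M.cycleRate_pos
  set w := (M.ρ₁ - M.ρ₀) * M.Dp + M.ρ₁ * M.υs with hw
  have hw0 : 0 ≤ w := add_nonneg (mul_nonneg (sub_nonneg.2 M.ρ₀_lt_ρ₁.le) Dp_nonneg)
    (mul_nonneg M.ρ₁_pos.le υs_nonneg)
  have hd : 0 < 1 - M.ρ₁ + (1 - ε) * w :=
    add_pos_of_pos_of_nonneg (sub_pos.2 M.ρ₁_lt_one) (mul_nonneg (sub_nonneg.2 h1.le) hw0)
  have hn : 0 < M.cycleRate * ε - M.ρ₀ * M.Dp := by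
    rw [div_lt_iff₀' hc] at h0
    linarith
  have hx' : x = (M.cycleRate * ε - M.ρ₀ * M.Dp) / (1 - M.ρ₁ + (1 - ε) * w) := by
    have e1 : ε - M.ρ₀ * M.Dp / M.cycleRate
        = (M.cycleRate * ε - M.ρ₀ * M.Dp) / M.cycleRate := by field_simp
    have e2 : 1 - M.ρ₀ * M.Dp / M.cycleRate + (1 - ε) * (w / M.cycleRate)
        = (1 - M.ρ₁ + (1 - ε) * w) / M.cycleRate := by
      field_simp
      rw [cycleRate]
      ring
    rw [hx, e1, e2, div_div_div_cancel_right₀ hc.ne']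
  have hxm : x * (1 - M.ρ₁ + (1 - ε) * w) = M.cycleRate * ε - M.ρ₀ * M.Dp := by
    rw [hx', div_mul_cancel₀ _ hd.ne']
  refine ⟨hx' ▸ div_pos hn hd, ?_, ?_⟩
  · rw [hx', div_lt_one hd]
    have := mul_nonneg (sub_nonneg.2 h1.le) hw0
    -- Denominator minus numerator is (1 - ε)(`cycleRate` + w).
    have := mul_pos (sub_pos.2 h1) hc
    unfold cycleRate at *
    linarith
  · rw [cycleRate] at hxm
    linear_combination hxm

end Model

end ChainDecoding

open ChainDecoding Model in
theorem theorem2 (M : ChainDecoding.Model) (θ : ℝ) (hθ0 : 0 < θ) (hθ1 : θ < 1) :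
    (M.nablaGA < θ → θ < M.nablaMax →
      ∃ m : ChainDecoding.CDState → unitInterval,
        (m (.U 0) : ℝ) = (θ - M.nablaGA) /
          (M.nablaMax - M.nablaGA + (M.nablaMax - θ) *
            (((M.ρ₁ - M.ρ₀) * M.Dp + M.ρ₁ * M.υs) / (1 - M.ρ₁ + M.ρ₀ * M.Dp))) ∧
        0 < (m (.U 0) : ℝ) ∧ (m (.U 0) : ℝ) < 1 ∧
        m .Kright = 1 ∧ m .Kboth = 1 ∧ (∀ b : ℕ, 0 < b → m (.U b) = 1) ∧
        M.IsOptimal θ (ChainDecoding.stationary m) ∧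
        M.throughput (ChainDecoding.stationary m) =
          M.genie (θ / M.nablaMax) -
            (1 - M.ρ₁) * (1 - M.ρ₁ + M.ρ₀ * M.Dp) * M.zeta * M.Rs / (1 - M.ρ₁ * (1 - M.Dp)) *
              ((θ - M.nablaGA) / M.nablaMax) ∧
        (0 < M.ρ₀ * M.Dp →
          M.throughput (ChainDecoding.stationary m) =
            M.genie (θ / M.nablaMax) -
              M.ρ₀ * M.Dp * (1 - M.ρ₁) * M.zeta * M.Rs / (1 - M.ρ₁ * (1 - M.Dp)) *
                ((θ - M.nablaGA) / M.nablaGA)) ∧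
        M.degradation (ChainDecoding.stationary m) = θ ∧
        Filter.Tendsto (M.avgReward (ChainDecoding.stationary m)) Filter.atTop
          (nhds (M.throughput (ChainDecoding.stationary m))) ∧
        Filter.Tendsto (fun D => M.nablaMax * M.avgTx (ChainDecoding.stationary m) D) Filter.atTop
          (nhds (M.degradation (ChainDecoding.stationary m)))) ∧
    (M.nablaMax ≤ θ →
      M.IsOptimal θ (ChainDecoding.stationary fun _ => 1) ∧
      M.throughput (ChainDecoding.stationary fun _ => 1) =
        M.genie 1 - (1 - M.ρ₁) ^ 2 / (1 - M.ρ₁ * (1 - M.Dp)) * M.zeta * M.Rs ∧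
      M.degradation (ChainDecoding.stationary fun _ => 1) = M.nablaMax ∧
      Filter.Tendsto (M.avgReward (ChainDecoding.stationary fun _ => 1)) Filter.atTop
        (nhds (M.throughput (ChainDecoding.stationary fun _ => 1))) ∧
      Filter.Tendsto (fun D => M.nablaMax * M.avgTx (ChainDecoding.stationary fun _ => 1) D)
        Filter.atTop (nhds (M.degradation (ChainDecoding.stationary fun _ => 1)))) := by
  have hN := M.nablaMax_pos
  have hN' := hN.ne'
  have hc := M.cycleRate_pos
  have hGA : M.nablaGA = M.ρ₀ * M.Dp / M.cycleRate * M.nablaMax := rfl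
  refine ⟨fun hθ hθ' => ?_, fun hθ => ?_⟩
  · have hθN : θ / M.nablaMax * M.nablaMax = θ := div_mul_cancel₀ _ hN'
    obtain ⟨x0, x1, hx⟩ := accessProb_mem (M := M) (ε := θ / M.nablaMax)
      (by rwa [lt_div_iff₀ hN, ← hGA]) ((div_lt_one hN).2 hθ') rfl
    set x := (θ / M.nablaMax - M.ρ₀ * M.Dp / M.cycleRate) / (1 - M.ρ₀ * M.Dp / M.cycleRate
      + (1 - θ / M.nablaMax) * (((M.ρ₁ - M.ρ₀) * M.Dp + M.ρ₁ * M.υs) / M.cycleRate)) with hxdef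
    have hval : x = (θ - M.nablaGA) / (M.nablaMax - M.nablaGA + (M.nablaMax - θ) *
        (((M.ρ₁ - M.ρ₀) * M.Dp + M.ρ₁ * M.υs) / (1 - M.ρ₁ + M.ρ₀ * M.Dp))) := by
      -- Multiplying numerator and denominator by `nablaMax` turns access rates into degradations.
      rw [hxdef, ← mul_div_mul_right _ _ hN', ← cycleRate, hGA]
      congr 1
      · rw [sub_mul, hθN]
      · linear_combination -(((M.ρ₁ - M.ρ₀) * M.Dp + M.ρ₁ * M.υs) / M.cycleRate) * hθN
    let m : CDState → unitInterval := fun s => if s = .U 0 then ⟨x, x0.le, x1.le⟩ else 1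
    have hm0 : (m (.U 0) : ℝ) = x := by simp [m]
    have hm : ∀ s, s ≠ .U 0 → m s = 1 := fun s hs => if_neg hs
    have hTx : Tendsto (M.avgTx (stationary m)) atTop (𝓝 (θ / M.nablaMax)) :=
      tendsto_avgTx hm (by rwa [hm0])
    have hRw := tendsto_avgReward hm hTx
    have hdeg : M.degradation (stationary m) = θ := by
      rw [degradation, hTx.limsup_eq, mul_div_cancel₀ _ hN']
    have hthr : M.throughput (stationary m) = M.genie (θ / M.nablaMax) -
        (1 - M.ρ₁) * M.cycleRate * M.zeta * M.Rs / M.exitRate *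
          ((θ - M.nablaGA) / M.nablaMax) := by
      rw [throughput, hRw.liminf_eq, gain_add_price_mul, sub_div, hGA, mul_div_cancel_right₀ _ hN']
    refine ⟨m, hm0.trans hval, by rwa [hm0], by rwa [hm0], hm _ (by simp), hm _ (by simp),
      fun b hb => hm _ (by simpa using hb.ne'), ?_, hthr, fun hpos => ?_, hdeg, ?_, ?_⟩
    · exact isOptimal_of_tendsto hm hTx (mul_div_cancel₀ _ hN').le
        fun ν => degradation_le_iff.1
    · have h1 : (θ - M.nablaGA) / M.nablaMax
          = M.ρ₀ * M.Dp / M.cycleRate * ((θ - M.nablaGA) / M.nablaGA) := by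
        rw [hGA]
        field_simp
        rw [mul_div_cancel_left₀ _ hpos.ne']
      rw [hthr, h1, ← exitRate]
      congr 1
      field_simp
    · rwa [throughput, hRw.liminf_eq]
    · rw [hdeg]
      simpa only [mul_div_cancel₀ _ hN'] using hTx.const_mul M.nablaMax
  -- Here ε = 1 and the access probability in `U 0` is 1, so both terms of the access-rate equation
  -- vanish. The bound needed for optimality is the trivial one, that no access rate exceeds 1.
  · have hTx : Tendsto (M.avgTx (stationary fun _ => 1)) atTop (𝓝 1) :=
      tendsto_avgTx (fun _ _ => rfl) (by simp)
    have hRw := tendsto_avgReward (m := fun _ => 1) (fun _ _ => rfl) hTx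
    have hdeg : M.degradation (stationary fun _ => 1) = M.nablaMax := by
      rw [degradation, hTx.limsup_eq, mul_one]
    refine ⟨isOptimal_of_tendsto (fun _ _ => rfl) hTx (by rwa [mul_one])
      fun ν _ => limsup_avgTx_le_one ν, ?_, hdeg, ?_, ?_⟩
    · have h1 : (1 - M.ρ₀ * M.Dp / M.cycleRate) = (1 - M.ρ₁) / M.cycleRate := by
        field_simp
        rw [cycleRate]
        ring
      rw [throughput, hRw.liminf_eq, gain_add_price_mul, h1, ← exitRate]
      congr 1
      field_simp
    · rwa [throughput, hRw.liminf_eq]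
    · rw [hdeg]
      simpa only [mul_one] using hTx.const_mul M.nablaMax
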